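/- Let $K$ be a field, let $X$ be an algebraic $K$-scheme (a scheme of finite type over $K$), let $n \in \mathbb{Z}$, and let $\mathscr{L}$ be a line bundle on $X$. Let $A_*X = \bigoplus_k A_kX$ be the Chow group of cycles modulo rational equivalence, graded by dimension, and let $c(\mathscr{L}) = 1 + c_1(\mathscr{L})$ act on $A_*X$ by cap product; this operator is invertible, since $c_1(\mathscr{L})\cap -$ lowers dimension by one. Write $\alpha \in A_*X$ as $\alpha = \sum_i \alpha^i$ with $\alpha^i$ of codimension $i$ in $X$, i.e. $\alpha^i \in A_{\dim X - i}X$, and put $$\alpha^{\vee} := \sum_i (-1)^i \alpha^i, \qquad \alpha \otimes_X \mathscr{L} := \sum_i c(\mathscr{L})^{-i} \cap \alpha^i .$$ Then the map $$i_{n,\mathscr{L}} : A_*X \to A_*X, \qquad \alpha \mapsto c(\mathscr{L})^n \cap \left(\alpha^{\vee} \otimes_X \mathscr{L}\right),$$ is an involutive automorphism of the abelian group $A_*X$: it is $\mathbb{Z}$-linear and bijective, and $i_{n,\mathscr{L}} \circ i_{n,\mathscr{L}} = \mathrm{id}_{A_*X}$. -/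

import Mathlib

open CategoryTheory AlgebraicGeometry TopologicalSpace

universe u

namespace ChowInvolution

/-! ### Algebraic schemes and their subvarieties -/

/-- An algebraic scheme over a field `K`: a scheme of finite type over `Spec K`. -/
structure AlgebraicScheme (K : Type u) [Field K] where
  /-- The underlying scheme. -/
  toScheme : Scheme.{u}
  /-- The structure morphism. -/
  structureMap : toScheme ⟶ Spec (CommRingCat.of K)
  locallyOfFiniteType : LocallyOfFiniteType structureMap
  quasiCompact : QuasiCompact structureMap

instance AlgebraicScheme.isNoetherian {K : Type u} [Field K] (X : AlgebraicScheme K) :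
    IsNoetherian X.toScheme := by
  have := X.locallyOfFiniteType
  have := X.quasiCompact
  have : IsLocallyNoetherian X.toScheme :=
    LocallyOfFiniteType.isLocallyNoetherian X.structureMap
  have : CompactSpace X.toScheme := QuasiCompact.compactSpace_of_compactSpace X.structureMap
  exact {}

section Subvariety

variable {X : Scheme.{u}} [IsNoetherian X]

/-- The subvariety of `X` with generic point `x`: the closure of `{x}` with its reduced structure,
realized as the scheme-theoretic image of `Spec κ(x) ⟶ X`. -/
noncomputable def subvariety (x : X) : Scheme.{u} := (X.fromSpecResidueField x).image

/-- The closed immersion of a subvariety. -/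
noncomputable def subvarietyι (x : X) : subvariety x ⟶ X := (X.fromSpecResidueField x).imageι

instance (x : X) : IsClosedImmersion (subvarietyι x) :=
  inferInstanceAs (IsClosedImmersion (X.fromSpecResidueField x).imageι)

instance (x : X) : IsIntegral (subvariety x) := by
  let f := X.fromSpecResidueField x
  have hred : IsReduced f.image := by
    have : ∀ y : f.image, _root_.IsReduced (f.image.presheaf.stalk y) := by
      intro y
      obtain ⟨_, ⟨U, hU, rfl⟩, hyU, -⟩ := X.isBasis_affineOpens.exists_subset_of_mem_open
        (Set.mem_univ (f.imageι y)) isOpen_univ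
      have hV : IsAffineOpen (f.imageι ⁻¹ᵁ U) := hU.preimage f.imageι
      have : _root_.IsReduced Γ(f.image, f.imageι ⁻¹ᵁ U) :=
        isReduced_of_injective _ (f.toImage_app_injective (U := ⟨U, hU⟩))
      have := hV.isLocalization_stalk ⟨y, hyU⟩
      let := TopCat.Presheaf.algebra_section_stalk f.image.presheaf
        (⟨y, hyU⟩ : (f.imageι ⁻¹ᵁ U : f.image.Opens))
      exact isReduced_localizationPreserves
        (hV.primeIdealOf ⟨y, hyU⟩).asIdeal.primeCompl _ inferInstance
    exact isReduced_of_isReduced_stalk _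
  have hirr : IrreducibleSpace f.image := by
    have hd : DenseRange f.toImage := f.toImage.denseRange
    have h1 : IsIrreducible (Set.univ : Set (Spec (X.residueField x))) :=
      IrreducibleSpace.isIrreducible_univ _
    have h2 := (h1.image f.toImage f.toImage.continuous.continuousOn).closure
    rw [Set.image_univ, hd.closure_range] at h2
    have : Nonempty f.image := ⟨f.toImage default⟩
    exact { isPreirreducible_univ := h2.2, toNonempty := this }
  exact isIntegral_of_irreducibleSpace_of_isReduced f.image

instance (x : X) : IsNoetherian (subvariety x) := by
  have : IsLocallyNoetherian (subvariety x) :=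
    LocallyOfFiniteType.isLocallyNoetherian (subvarietyι x)
  have : CompactSpace (subvariety x) :=
    QuasiCompact.compactSpace_of_compactSpace (subvarietyι x)
  exact {}

lemma range_subvarietyι {X : Scheme.{u}} (x : X) : Set.range (subvarietyι x) = closure {x} := by
  have := Scheme.IdealSheafData.range_subschemeι (X.fromSpecResidueField x).ker
  rw [Scheme.Hom.support_ker, Scheme.range_fromSpecResidueField] at this
  exact this

lemma subvarietyι_genericPoint {X : Scheme.{u}} (x : X) : subvarietyι x (genericPoint (subvariety x)) = x := by
  have h := ((genericPoint_spec (subvariety x)).image (subvarietyι x).continuous)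
  rw [Set.image_univ, range_subvarietyι, closure_closure] at h
  exact h.eq isGenericPoint_closure

end Subvariety

/-! ### Divisors of rational functions, rational equivalence, Chow groups -/

/-- The prime divisors of an integral Noetherian scheme that miss a given nonempty open set
are finite in number. -/
lemma finite_coheight_one_compl (W : Scheme.{u}) [IsIntegral W] [IsNoetherian W]
    (U : W.Opens) (hU : genericPoint W ∈ U) :
    {z : W | Order.coheight z = 1 ∧ z ∉ U}.Finite := by
  classical
  obtain ⟨S, hS, hcl, hirr, hun⟩ := NoetherianSpace.exists_finite_set_isClosed_irreducible
    (U.isOpen.isClosed_compl)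
  have hsub : {z : W | Order.coheight z = 1 ∧ z ∉ U} ⊆
      {z : W | ∃ T ∈ S, IsGenericPoint z T} := by
    rintro z ⟨hz, hzU⟩
    have hzS : z ∈ ⋃₀ S := hun ▸ hzU
    obtain ⟨T, hT, hzT⟩ := hzS
    obtain ⟨t, ht⟩ := QuasiSober.sober (hirr T hT) (hcl T hT)
    have htU : t ∉ U := by
      have : t ∈ (U : Set W)ᶜ := hun ▸ ⟨T, hT, ht.mem⟩
      exact this
    have hzt : z ≤ t := Scheme.le_iff_specializes.mpr (ht.specializes hzT)
    have hte : t ≤ genericPoint W :=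
      Scheme.le_iff_specializes.mpr ((genericPoint_spec W).specializes trivial)
    have hne : t ≠ genericPoint W := fun h => htU (h ▸ hU)
    have hlt : ∀ {a b : W}, a ≤ b → a ≠ b → a < b := fun {a b} hab h =>
      lt_of_le_not_ge hab fun hba => h ((Scheme.le_iff_specializes.mp hba).antisymm
        (Scheme.le_iff_specializes.mp hab)).eq
    have h1 : 1 ≤ Order.coheight t := by
      have := Order.coheight_add_one_le (hlt hte hne)
      exact le_trans (by simp) this
    have hzt' : z = t := by
      by_contra h
      have h2 := Order.coheight_add_one_le (hlt hzt h)
      rw [hz] at h2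
      have : (1 : ℕ∞) + 1 ≤ 1 := le_trans (by gcongr) h2
      exact absurd this (by decide)
    exact ⟨T, hT, hzt' ▸ ht⟩
  refine Set.Finite.subset ?_ hsub
  have : {z : W | ∃ T ∈ S, IsGenericPoint z T} = ⋃ T ∈ S, {z : W | IsGenericPoint z T} := by
    ext; simp
  rw [this]
  refine hS.biUnion fun T _ => Set.Subsingleton.finite fun a ha b hb => ?_
  exact IsGenericPoint.eq ha hb

lemma finite_support_ord (W : Scheme.{u}) [IsIntegral W] [IsNoetherian W]
    (f : W.functionField) : (Function.support fun z => Scheme.ord f z).Finite := by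
  by_cases hf : f = 0
  · simp [hf]
  obtain ⟨U, -, f', hne, rfl, hu⟩ := exists_isUnit_germ_eq W f hf
  refine (finite_coheight_one_compl W U
    (((genericPoint_spec W).mem_open_set_iff U.isOpen).mpr (by simpa using hne))).subset ?_
  intro z hz
  refine ⟨?_, fun hzU => hz (Scheme.ord_of_isUnit hu hzU)⟩
  by_contra h
  exact hz (Scheme.ord_eq_zero_of_coheight_neq_one h _)

section Chow

variable (X : Scheme.{u}) [IsNoetherian X]

/-- The group of `k`-cycles on `X`: finite formal `ℤ`-linear combinations of `k`-dimensional
subvarieties, each named by its generic point. Since `a ≤ b` means that `b` specializes to `a`,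
`Order.height x` is the dimension of the closure of `x`. -/
abbrev Cycle (k : ℕ) : Type u := {x : X // Order.height x = k} →₀ ℤ

variable {X}

/-- The `k`-dimensional part of the pushforward to `X` of a cycle on the subvariety with generic
point `x`. -/
noncomputable def pushCycle (x : X) (k : ℕ) (D : subvariety x →₀ ℤ) : Cycle X k :=
  (D.mapDomain (subvarietyι x)).subtypeDomain fun y : X => Order.height y = k

/-- The `k`-cycle `[div f] = ∑ ord_Z(f) [Z]`, for a rational function `f` on the
`(k+1)`-dimensional subvariety with generic point `x`. -/
noncomputable def divCycle (x : X) (k : ℕ) (f : (subvariety x).functionField) : Cycle X k :=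
  pushCycle x k (Finsupp.ofSupportFinite (fun z => Scheme.ord f z) (finite_support_ord _ f))

variable (X)

/-- The `k`-cycles rationally equivalent to zero: the subgroup generated by the `[div f]`, for
nonzero rational functions `f` on `(k+1)`-dimensional subvarieties. -/
noncomputable def ratEquivZero (k : ℕ) : Submodule ℤ (Cycle X k) :=
  Submodule.span ℤ {D | ∃ x : X, Order.height x = (k + 1 : ℕ) ∧
    ∃ f : (subvariety x).functionField, f ≠ 0 ∧ D = divCycle x k f}

/-- `A_k X`. -/
abbrev ChowGroup (k : ℕ) : Type u := Cycle X k ⧸ ratEquivZero X k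

/-- `A_* X`, the direct sum of the groups `A_k X`. -/
abbrev Chow : Type u := DirectSum ℕ fun k => ChowGroup X k

/-- The dimension of `X` (`0` when `X` is empty, in which case `A_* X` is trivial). -/
noncomputable def dimension : ℤ := ((topologicalKrullDim X).unbotD 0).toNat

end Chow

/-! ### Line bundles and their first Chern class -/

section LineBundle

variable {X : Scheme.{u}}

/-- `t` is a frame (nowhere vanishing section) of `L` over `U`: multiplication by `t` is an
isomorphism from `𝒪_U` to the restriction of `L` to `U`. -/
def IsFrame (L : X.Modules) (U : X.Opens) (t : Γ(L, U)) : Prop :=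
  ∀ (V : X.Opens) (h : V ≤ U),
    Function.Bijective fun a : Γ(X, V) => a • L.presheaf.map (homOfLE h).op t

variable (X) in
/-- A line bundle: a sheaf of modules locally isomorphic to `𝒪_X`. -/
structure LineBundle where
  /-- The sheaf of sections. -/
  sheaf : X.Modules
  exists_frame : ∀ x : X, ∃ U : X.Opens, x ∈ U ∧ ∃ t : Γ(sheaf, U), IsFrame sheaf U t

namespace LineBundle

variable (L : LineBundle X)

/-- An open neighbourhood of `x` over which `L` is trivial. -/
noncomputable def nhd (x : X) : X.Opens := (L.exists_frame x).choose

lemma mem_nhd (x : X) : x ∈ L.nhd x := (L.exists_frame x).choose_spec.1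

/-- A frame of `L` near `x`. -/
noncomputable def frame (x : X) : Γ(L.sheaf, L.nhd x) := (L.exists_frame x).choose_spec.2.choose

lemma isFrame (x : X) : IsFrame L.sheaf (L.nhd x) (L.frame x) :=
  (L.exists_frame x).choose_spec.2.choose_spec

/-- The transition function `u ∈ 𝒪(U_x ∩ U_y)` with `frame x = u • frame y`. -/
noncomputable def transition (x y : X) : Γ(X, L.nhd x ⊓ L.nhd y) :=
  ((L.isFrame y _ inf_le_right).2
    (L.sheaf.presheaf.map (homOfLE (inf_le_left : L.nhd x ⊓ L.nhd y ≤ L.nhd x)).op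
      (L.frame x))).choose

lemma transition_spec (x y : X) :
    L.transition x y • L.sheaf.presheaf.map
        (homOfLE (inf_le_right : L.nhd x ⊓ L.nhd y ≤ L.nhd y)).op (L.frame y) =
      L.sheaf.presheaf.map (homOfLE (inf_le_left : L.nhd x ⊓ L.nhd y ≤ L.nhd x)).op
        (L.frame x) :=
  ((L.isFrame y _ inf_le_right).2 _).choose_spec

lemma isUnit_transition (x y : X) : IsUnit (L.transition x y) := by
  obtain ⟨v, hv⟩ := (L.isFrame x _ (inf_le_left : L.nhd x ⊓ L.nhd y ≤ L.nhd x)).2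
    (L.sheaf.presheaf.map (homOfLE (inf_le_right : L.nhd x ⊓ L.nhd y ≤ L.nhd y)).op (L.frame y))
  refine IsUnit.of_mul_eq_one v ((L.isFrame x _ inf_le_left).1 ?_)
  simp only at hv ⊢
  rw [mul_smul, hv, one_smul, transition_spec]

variable [IsNoetherian X]

lemma genericPoint_mem {X : Scheme.{u}} (L : LineBundle X) (x : X) (z : subvariety x) :
    genericPoint (subvariety x) ∈ subvarietyι x ⁻¹ᵁ (L.nhd x ⊓ L.nhd (subvarietyι x z)) := by
  refine ⟨?_, ?_⟩
  · change subvarietyι x (genericPoint (subvariety x)) ∈ L.nhd x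
    rw [subvarietyι_genericPoint]
    exact L.mem_nhd x
  · exact ((genericPoint_spec (subvariety x)).mem_open_set_iff
      (subvarietyι x ⁻¹ᵁ L.nhd (subvarietyι x z)).isOpen).mpr
        ⟨z, trivial, L.mem_nhd (subvarietyι x z)⟩

/-- Let `V` be the subvariety with generic point `x`. The frame of `L` near `x` is a rational
section `s` of `L|_V`; this is the local equation of its divisor at `z ∈ V`, that is, the
rational function `g` on `V` such that `s = g t`, where `t` is a frame of `L` near `z`. -/
noncomputable def localEquation (x : X) (z : subvariety x) : (subvariety x).functionField :=
  (subvariety x).presheaf.germ _ (genericPoint (subvariety x)) (L.genericPoint_mem x z)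
    ((subvarietyι x).app _ (L.transition x (subvarietyι x z)))

lemma finite_support_localEquation (x : X) :
    (Function.support fun z => Scheme.ord (L.localEquation x z) z).Finite := by
  refine (finite_coheight_one_compl (subvariety x) (subvarietyι x ⁻¹ᵁ L.nhd x) ?_).subset ?_
  · exact (L.genericPoint_mem x (genericPoint _)).1
  · intro z hz
    refine ⟨?_, fun hzU => hz ?_⟩
    · by_contra h
      exact hz (Scheme.ord_eq_zero_of_coheight_neq_one h _)
    · let U := subvarietyι x ⁻¹ᵁ (L.nhd x ⊓ L.nhd (subvarietyι x z))
      have hzV : z ∈ U := ⟨hzU, L.mem_nhd (subvarietyι x z)⟩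
      have : Nonempty U := ⟨⟨z, hzV⟩⟩
      exact Scheme.ord_of_isUnit (U := U)
        ((L.isUnit_transition x (subvarietyι x z)).map ((subvarietyι x).app _).hom) hzV

/-- The `k`-cycle `[div s]` of a rational section `s` of the restriction of `L` to the
`(k+1)`-dimensional subvariety with generic point `x`. -/
noncomputable def sectionCycle (x : X) (k : ℕ) : Cycle X k :=
  pushCycle x k (Finsupp.ofSupportFinite (fun z => Scheme.ord (L.localEquation x z) z)
    (L.finite_support_localEquation x))

/-- The cap product with `c₁(L)` on cycles: it sends `[V]` to the class of the divisor of a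
rational section of `L|_V`. Another section changes this divisor by some `[div f]`. -/
noncomputable def capCycle (k : ℕ) : Cycle X (k + 1) →ₗ[ℤ] ChowGroup X k :=
  Finsupp.linearCombination ℤ fun x => (ratEquivZero X k).mkQ (L.sectionCycle x.1 k)

open Classical in
/-- The cap product with `c₁(L)`, from `A_{k+1} X` to `A_k X`: the homomorphism induced by
`capCycle` on rational equivalence classes. For a scheme of finite type over a field `capCycle`
kills the cycles rationally equivalent to zero (a standard fact of intersection theory), so the
`else` branch, needed only for the definition to be total, does not occur there. -/
noncomputable def capDegree (k : ℕ) : ChowGroup X (k + 1) →ₗ[ℤ] ChowGroup X k :=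
  if h : ratEquivZero X (k + 1) ≤ LinearMap.ker (L.capCycle k) then
    (ratEquivZero X (k + 1)).liftQ (L.capCycle k) h
  else 0

/-- The cap product with `c₁(L)` as an endomorphism of `A_* X`. -/
noncomputable def firstChern : Module.End ℤ (Chow X) :=
  DirectSum.toModule ℤ ℕ (Chow X) fun k => match k with
    | 0 => 0
    | k + 1 => DirectSum.lof ℤ ℕ (fun k => ChowGroup X k) k ∘ₗ L.capDegree k

lemma firstChern_lof_zero (a : ChowGroup X 0) :
    L.firstChern (DirectSum.lof ℤ ℕ (fun k => ChowGroup X k) 0 a) = 0 := by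
  simp [firstChern, DirectSum.toModule_lof]

lemma firstChern_lof_succ (k : ℕ) (a : ChowGroup X (k + 1)) :
    L.firstChern (DirectSum.lof ℤ ℕ (fun k => ChowGroup X k) (k + 1) a) =
      DirectSum.lof ℤ ℕ (fun k => ChowGroup X k) k (L.capDegree k a) := by
  simp [firstChern, DirectSum.toModule_lof]

lemma exists_pow_firstChern (α : Chow X) : ∃ m : ℕ, (L.firstChern ^ m) α = 0 := by
  have hof : ∀ (k : ℕ) (a : ChowGroup X k),
      (L.firstChern ^ (k + 1)) (DirectSum.lof ℤ ℕ (fun k => ChowGroup X k) k a) = 0 := by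
    intro k
    induction k with
    | zero => intro a; simpa using L.firstChern_lof_zero a
    | succ k ih => intro a; rw [pow_succ, Module.End.mul_apply, firstChern_lof_succ, ih]
  induction α using DirectSum.induction_on with
  | zero => exact ⟨0, by simp⟩
  | of k a => exact ⟨k + 1, hof k a⟩
  | add α β hα hβ =>
    obtain ⟨m, hm⟩ := hα
    obtain ⟨n, hn⟩ := hβ
    refine ⟨m + n, ?_⟩
    rw [map_add, add_comm m n, pow_add, Module.End.mul_apply, hm, ← pow_add, add_comm n m,
      pow_add, Module.End.mul_apply, hn]
    simp

lemma isUnit_one_add_firstChern : IsUnit (1 + L.firstChern) := by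
  rw [Module.End.isUnit_iff]
  constructor
  · rw [injective_iff_map_eq_zero]
    intro α hα
    have h1 : L.firstChern α = -α := by
      have : α + L.firstChern α = 0 := by simpa using hα
      exact (neg_eq_of_add_eq_zero_right this).symm
    have h2 : ∀ m : ℕ, (L.firstChern ^ m) α = (-1 : ℤ) ^ m • α := by
      intro m
      induction m with
      | zero => simp
      | succ m ih => rw [pow_succ, Module.End.mul_apply, h1, map_neg, ih, pow_succ]; simp
    obtain ⟨m, hm⟩ := L.exists_pow_firstChern α
    rw [h2] at hm
    rcases neg_one_pow_eq_or ℤ m with h | h <;> simpa [h] using hm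
  · have key : ∀ (m : ℕ) (β : Chow X), (L.firstChern ^ m) β = 0 →
        ∃ α, (1 + L.firstChern) α = β := by
      intro m
      induction m with
      | zero => intro β h; exact ⟨0, by simpa using h.symm⟩
      | succ m ih =>
        intro β h
        rw [pow_succ, Module.End.mul_apply] at h
        obtain ⟨α, hα⟩ := ih _ h
        refine ⟨β - α, ?_⟩
        rw [map_sub, hα]
        simp only [LinearMap.add_apply, Module.End.one_apply]
        abel
    intro β
    obtain ⟨m, hm⟩ := L.exists_pow_firstChern β
    exact key m β hm

/-- The total Chern class `c(L) = 1 + c₁(L)`, as an invertible operator on `A_* X`; for an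
integer `n`, the operator `c(L)^n ∩ -` is its `n`-th power. -/
noncomputable def totalChern : (Module.End ℤ (Chow X))ˣ := L.isUnit_one_add_firstChern.unit

end LineBundle

end LineBundle

/-! ### The dual, tensoring by a line bundle, and the involutions -/

section Involution

variable {X : Scheme.{u}} [IsNoetherian X]

open Classical in
/-- `α^∨ = ∑ (-1)^i α^i`, where `α^i` is the component of codimension `i`, that is, of dimension
`dim X - i`. -/
noncomputable def dual (α : Chow X) : Chow X :=
  ∑ k ∈ DFinsupp.support α,
    ((dimension X - k).negOnePow : ℤ) • DirectSum.of (fun k => ChowGroup X k) k (α k)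

open Classical in
/-- `α ⊗ L = ∑ c(L)^{-i} ∩ α^i`, where `α^i` is the component of codimension `i`. -/
noncomputable def tensor (α : Chow X) (L : LineBundle X) : Chow X :=
  ∑ k ∈ DFinsupp.support α,
    (L.totalChern ^ (-(dimension X - k))).val (DirectSum.of (fun k => ChowGroup X k) k (α k))

/-- `i_{n,L}(α) = c(L)^n ∩ (α^∨ ⊗ L)`. -/
noncomputable def involution (n : ℤ) (L : LineBundle X) (α : Chow X) : Chow X :=
  (L.totalChern ^ n).val (tensor (dual α) L)

end Involution

end ChowInvolution

namespace ChowInvolution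

/-! ### Dual and tensor product as linear operators. -/

section LinearForms

variable {X : Scheme.{u}} [IsNoetherian X]

/-! Write `c = c(L) = 1 + c₁` and let `T` be the operator `α ↦ α^∨ ⊗ L`, which acts on classes of
codimension `i` as `(-1)^i c^{-i}`. Since `c₁` raises codimension by one and commutes with powers of
`c`, moving it past `T` costs one sign and one factor `c⁻¹`: `T c₁ = -c⁻¹ c₁ T`. Hence `T c = (1 -
c⁻¹ c₁) T = c⁻¹ T`, the last step being `c⁻¹(1 + c₁) = 1`, and so `T c^m = c^{-m} T` for every
integer `m` (`tensorEnd_mul_dualEnd_mul_totalChern_zpow`). This relation gives `T² = 1` degree by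
degree (`tensorEnd_mul_dualEnd_mul_self`), and then `(c^n T)² = c^n c^{-n} T² = 1`. The only
geometric input is that `c₁` lowers dimension by one. -/

variable (X) in
/-- The dual `α ↦ α^∨` as an endomorphism of `A_* X`. -/
noncomputable def dualEnd : Module.End ℤ (Chow X) :=
  DirectSum.toModule ℤ ℕ (Chow X) fun k =>
    ((dimension X - k).negOnePow : ℤ) • DirectSum.lof ℤ ℕ (fun k => ChowGroup X k) k

/-- The map `α ↦ α ⊗ L` as an endomorphism of `A_* X`. -/
noncomputable def tensorEnd (L : LineBundle X) : Module.End ℤ (Chow X) :=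
  DirectSum.toModule ℤ ℕ (Chow X) fun k =>
    (L.totalChern ^ (-(dimension X - k))).val ∘ₗ DirectSum.lof ℤ ℕ (fun k => ChowGroup X k) k

lemma dualEnd_lof (k : ℕ) (a : ChowGroup X k) :
    dualEnd X (DirectSum.lof ℤ ℕ (fun k => ChowGroup X k) k a) =
      ((dimension X - k).negOnePow : ℤ) • DirectSum.lof ℤ ℕ (fun k => ChowGroup X k) k a := by
  simp [dualEnd, DirectSum.toModule_lof]

lemma tensorEnd_lof (L : LineBundle X) (k : ℕ) (a : ChowGroup X k) :
    tensorEnd L (DirectSum.lof ℤ ℕ (fun k => ChowGroup X k) k a) =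
      (L.totalChern ^ (-(dimension X - k))).val
        (DirectSum.lof ℤ ℕ (fun k => ChowGroup X k) k a) := by
  simp [tensorEnd, DirectSum.toModule_lof]

/-- The index set of the sum defining `dual` varies with `α`, which hides additivity; the linear
form makes it available. -/
lemma dual_eq_dualEnd (α : Chow X) : dual α = dualEnd X α := by
  classical
  conv_rhs => rw [← DirectSum.sum_support_of α, map_sum]
  -- The two supports can differ only in their decidability instances.
  refine Finset.sum_congr (by congr!) fun k _ => ?_
  exact (dualEnd_lof k (α k)).symm

lemma tensor_eq_tensorEnd (L : LineBundle X) (α : Chow X) : tensor α L = tensorEnd L α := by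
  classical
  conv_rhs => rw [← DirectSum.sum_support_of α, map_sum]
  refine Finset.sum_congr (by congr!) fun k _ => ?_
  exact (tensorEnd_lof L k (α k)).symm

lemma tensorEnd_mul_dualEnd_lof (L : LineBundle X) (k : ℕ) (a : ChowGroup X k) :
    (tensorEnd L * dualEnd X) (DirectSum.lof ℤ ℕ (fun k => ChowGroup X k) k a) =
      ((dimension X - k).negOnePow : ℤ) • (L.totalChern ^ (-(dimension X - k))).val
        (DirectSum.lof ℤ ℕ (fun k => ChowGroup X k) k a) := by
  rw [Module.End.mul_apply, dualEnd_lof, map_smul, tensorEnd_lof]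

end LinearForms

/-! ### Commutation of the twisted dual with Chern classes. -/

namespace LineBundle

variable {X : Scheme.{u}} [IsNoetherian X] (L : LineBundle X)

lemma val_totalChern : (L.totalChern : Module.End ℤ (Chow X)) = 1 + L.firstChern := rfl

lemma commute_firstChern_totalChern_zpow (m : ℤ) :
    Commute L.firstChern (L.totalChern ^ m).val := by
  refine Commute.units_zpow_right ?_ m
  rw [val_totalChern]
  exact (Commute.one_right _).add_right (Commute.refl _)

/-- The map `α ↦ α^∨ ⊗ L` intertwines `c₁(L)` and `-c(L)⁻¹ c₁(L)`. -/
lemma tensorEnd_mul_dualEnd_mul_firstChern_add :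
    tensorEnd L * dualEnd X * L.firstChern +
      (L.totalChern⁻¹).val * L.firstChern * (tensorEnd L * dualEnd X) = 0 := by
  refine DirectSum.linearMap_ext _ fun k => LinearMap.ext fun a => ?_
  simp only [LinearMap.comp_apply, LinearMap.add_apply, LinearMap.zero_apply]
  have hcomm (m : ℤ) (v : Chow X) :
      ((L.totalChern⁻¹).val * L.firstChern) ((L.totalChern ^ m).val v) =
        (L.totalChern⁻¹ * L.totalChern ^ m).val (L.firstChern v) := by
    rw [← Module.End.mul_apply, mul_assoc, (L.commute_firstChern_totalChern_zpow m).eq,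
      ← mul_assoc, ← Units.val_mul, Module.End.mul_apply]
  rw [Module.End.mul_apply _ L.firstChern, Module.End.mul_apply _ (tensorEnd L * dualEnd X),
    tensorEnd_mul_dualEnd_lof, map_smul, hcomm]
  -- In dimension 0 both terms vanish, because `c₁` kills `A_0`.
  cases k with
  | zero => simp [firstChern_lof_zero]
  | succ k =>
    rw [firstChern_lof_succ, tensorEnd_mul_dualEnd_lof]
    -- Passing from dimension `k + 1` to `k` raises the codimension by one, which produces the sign
    -- here and the factor `c⁻¹` in `hpow`.
    have hsign : (dimension X - (k : ℤ)).negOnePow =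
        -(dimension X - ((k + 1 : ℕ) : ℤ)).negOnePow := by
      rw [← Int.negOnePow_succ]
      congr 1
      push_cast
      ring
    have hpow : L.totalChern ^ (-(dimension X - (k : ℤ))) =
        L.totalChern⁻¹ * L.totalChern ^ (-(dimension X - ((k + 1 : ℕ) : ℤ))) := by
      rw [← zpow_neg_one, ← zpow_add]
      congr 1
      push_cast
      ring
    rw [hsign, hpow, Units.val_neg, neg_smul, neg_add_cancel]

/-- `(c(L) ∩ α)^∨ ⊗ L = c(L)⁻¹ ∩ (α^∨ ⊗ L)`. -/
lemma semiconjBy_tensorEnd_mul_dualEnd :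
    SemiconjBy (tensorEnd L * dualEnd X) L.totalChern.val (L.totalChern⁻¹).val := by
  have hinv : (L.totalChern⁻¹).val + (L.totalChern⁻¹).val * L.firstChern = 1 := by
    rw [← L.totalChern.inv_mul, val_totalChern, mul_add, mul_one]
  calc tensorEnd L * dualEnd X * L.totalChern.val
    _ = ((L.totalChern⁻¹).val + (L.totalChern⁻¹).val * L.firstChern) *
          (tensorEnd L * dualEnd X) + tensorEnd L * dualEnd X * L.firstChern := by
      rw [hinv, one_mul, val_totalChern, mul_add, mul_one]
    _ = (L.totalChern⁻¹).val * (tensorEnd L * dualEnd X) := by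
      rw [add_mul, add_assoc, add_comm (_ * L.firstChern * _),
        tensorEnd_mul_dualEnd_mul_firstChern_add, add_zero]

/-- Semiconjugation of units passes to inverses, so negative exponents are covered too. -/
lemma tensorEnd_mul_dualEnd_mul_totalChern_zpow (m : ℤ) :
    tensorEnd L * dualEnd X * (L.totalChern ^ m).val =
      (L.totalChern ^ (-m)).val * (tensorEnd L * dualEnd X) := by
  have := L.semiconjBy_tensorEnd_mul_dualEnd.units_zpow_right m
  rwa [inv_zpow'] at this

/-- The case `n = 0`: the map `α ↦ α^∨ ⊗ L` is an involution. -/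
lemma tensorEnd_mul_dualEnd_mul_self :
    tensorEnd L * dualEnd X * (tensorEnd L * dualEnd X) = 1 := by
  refine DirectSum.linearMap_ext _ fun k => LinearMap.ext fun a => ?_
  simp only [LinearMap.comp_apply]
  -- In codimension `i` the first application gives `(-1)^i c^{-i} a`. Moving the second past
  -- `c^{-i}` turns it into `c^i`, which cancels the new `c^{-i}`; the two signs multiply to 1.
  rw [Module.End.mul_apply _ (tensorEnd L * dualEnd X), tensorEnd_mul_dualEnd_lof, map_smul,
    ← Module.End.mul_apply, tensorEnd_mul_dualEnd_mul_totalChern_zpow, Module.End.mul_apply,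
    tensorEnd_mul_dualEnd_lof, map_smul, smul_smul, ← Units.val_mul, Int.units_mul_self,
    ← Module.End.mul_apply, ← Units.val_mul, ← zpow_add]
  simp

end LineBundle

/-! ### The involutions for arbitrary `n`. -/

section Involution

variable {X : Scheme.{u}} [IsNoetherian X]

/-- `i_{n,L}` as an endomorphism of `A_* X`. -/
noncomputable def involutionEnd (n : ℤ) (L : LineBundle X) : Module.End ℤ (Chow X) :=
  (L.totalChern ^ n).val * (tensorEnd L * dualEnd X)

lemma involution_eq_involutionEnd (n : ℤ) (L : LineBundle X) (α : Chow X) :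
    involution n L α = involutionEnd n L α := by
  rw [involution, tensor_eq_tensorEnd, dual_eq_dualEnd]
  rfl

/-- The inner factor `c^n` becomes `c^{-n}` on crossing the twisted dual and cancels the outer one,
which reduces the claim to `n = 0`. -/
lemma involutionEnd_mul_self (n : ℤ) (L : LineBundle X) :
    involutionEnd n L * involutionEnd n L = 1 := by
  rw [involutionEnd, mul_assoc, ← mul_assoc (tensorEnd L * dualEnd X),
    L.tensorEnd_mul_dualEnd_mul_totalChern_zpow, mul_assoc, L.tensorEnd_mul_dualEnd_mul_self,
    mul_one, ← Units.val_mul, ← zpow_add, add_neg_cancel, zpow_zero, Units.val_one]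

end Involution

end ChowInvolution

theorem proposition3p1 {K : Type u} [Field K] (X : ChowInvolution.AlgebraicScheme K) (n : ℤ)
    (L : ChowInvolution.LineBundle X.toScheme) :
    (∃ e : ChowInvolution.Chow X.toScheme ≃ₗ[ℤ] ChowInvolution.Chow X.toScheme,
      ∀ α, e α = ChowInvolution.involution n L α) ∧
    ∀ α : ChowInvolution.Chow X.toScheme,
      ChowInvolution.involution n L (ChowInvolution.involution n L α) = α := by
  have h := ChowInvolution.involutionEnd_mul_self n L
  -- The operator is its own inverse, so `h` serves for both composites.
  refine ⟨⟨LinearEquiv.ofLinearMap _ _ h h, fun α => ?_⟩, fun α => ?_⟩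
  · rw [ChowInvolution.involution_eq_involutionEnd, LinearEquiv.coe_ofLinearMap]
  · rw [ChowInvolution.involution_eq_involutionEnd, ChowInvolution.involution_eq_involutionEnd,
      ← Module.End.mul_apply, h, Module.End.one_apply]
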